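/- Fundamental Theorem of Abelian Algebras. All algebras are non-empty, with finitary fundamental operations. A variety is the class of all algebras of a given signature that satisfy a given set of identities; it is congruence modular if the lattice $\mathrm{Con}(B)$ of congruences of $B$ is modular for every algebra $B$ in it. For congruences $\alpha,\beta,\delta$ of an algebra $A$, write $C(\alpha,\beta;\delta)$ if for all $m,n\in\mathbb N$, every $(m+n)$-ary term $t$, all $\mathbf a^1,\mathbf a^2\in A^m$ with $a^1_i\,\alpha\,a^2_i$ for every $i$, and all $\mathbf b^1,\mathbf b^2\in A^n$ with $b^1_j\,\beta\,b^2_j$ for every $j$, \[t(\mathbf a^1,\mathbf b^1)\;\delta\;t(\mathbf a^1,\mathbf b^2)\ \Longrightarrow\ t(\mathbf a^2,\mathbf b^1)\;\delta\;t(\mathbf a^2,\mathbf b^2).\] The commutator is $[\alpha,\beta]:=\bigwedge\{\delta\in\mathrm{Con}(A): C(\alpha,\beta;\delta)\}$, and $A$ is Abelian if $[1_A,1_A]=0_A$, where $1_A$ and $0_A$ are the largest and the smallest congruence of $A$. A polynomial of $A$ is an operation $\mathbf x\mapsto t(\mathbf x,\mathbf c)$ on $A$ with $t$ a term and $\mathbf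 c$ a fixed tuple of elements of $A$. Two algebras, possibly of different signatures, are polynomially equivalent if they have the same underlying set and the same polynomials. An algebra is affine if it is polynomially equivalent to a module over a ring, the module being regarded as an algebra with operations $0$, $-$, $+$ and multiplication by each scalar. Theorem. Let $A$ be an algebra in a congruence modular variety. Then $A$ is Abelian if and only if $A$ is affine. -/

import Mathlib

universe u v w u' v'

namespace UniversalAlgebra

open FirstOrder.Language.Structure

/-! An algebra of signature `L` is a structure for a first-order language `L` without relation
symbols. -/

section Congruences

variable (L : FirstOrder.Language.{u, v}) (A : Type w) [L.Structure A]

/-- A congruence of `A`: an equivalence relation compatible with the fundamental operations. -/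
structure Congruence extends Setoid A where
  compat : ∀ {n : ℕ} (f : L.Functions n) (x y : Fin n → A),
    (∀ i, r (x i) (y i)) → r (funMap f x) (funMap f y)

variable {L A}

namespace Congruence

theorem toSetoid_injective :
    Function.Injective (Congruence.toSetoid : Congruence L A → Setoid A) := by
  rintro ⟨s, hs⟩ ⟨t, ht⟩ h
  cases h
  rfl

/-- Congruences are ordered by inclusion. -/
instance : PartialOrder (Congruence L A) :=
  PartialOrder.lift Congruence.toSetoid toSetoid_injective

/-- The meet of a set of congruences is their intersection. -/
instance : InfSet (Congruence L A) where
  sInf S :=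
    { r := fun x y => ∀ θ ∈ S, θ.r x y
      iseqv :=
        ⟨fun x θ _ => θ.iseqv.refl x, fun h θ hθ => θ.iseqv.symm (h θ hθ),
          fun h₁ h₂ θ hθ => θ.iseqv.trans (h₁ θ hθ) (h₂ θ hθ)⟩
      compat := fun f x y h θ hθ => θ.compat f x y fun i => h i θ hθ }

/-- The bottom congruence `0_A` is equality. -/
instance : Bot (Congruence L A) where
  bot :=
    { r := fun x y => x = y
      iseqv := ⟨fun _ => rfl, fun h => h.symm, fun h₁ h₂ => h₁.trans h₂⟩
      compat := fun _ _ _ h => congrArg _ (funext h) }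

/-- The top congruence `1_A` relates any two elements. -/
instance : Top (Congruence L A) where
  top :=
    { r := fun _ _ => True
      iseqv := ⟨fun _ => trivial, fun _ => trivial, fun _ _ => trivial⟩
      compat := fun _ _ _ _ => trivial }

theorem isGLB_sInf (S : Set (Congruence L A)) : IsGLB S (sInf S) :=
  ⟨fun θ hθ _ _ h => h θ hθ, fun _ hφ _ _ h θ hθ => hφ hθ h⟩

/-- The congruence lattice `Con(A)`. -/
instance : CompleteLattice (Congruence L A) :=
  { completeLatticeOfInf (Congruence L A) isGLB_sInf with
    bot := ⊥
    bot_le := fun θ _ y h => Eq.subst (motive := fun z => θ.r z y) (Eq.symm h) (θ.iseqv.refl y)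
    top := ⊤
    le_top := fun _ _ _ _ => trivial }

end Congruence

end Congruences

section Commutator

variable {L : FirstOrder.Language.{u, v}} {A : Type w} [L.Structure A]

/-- `C(α, β; δ)`: the `α, β`-term condition modulo `δ`. A term in `Fin m ⊕ Fin n` is an
`(m + n)`-ary term whose variables are split into a block of `m` and a block of `n`. -/
def Centralizes (α β δ : Congruence L A) : Prop :=
  ∀ (m n : ℕ) (t : L.Term (Fin m ⊕ Fin n)) (a₁ a₂ : Fin m → A) (b₁ b₂ : Fin n → A),
    (∀ i, α.r (a₁ i) (a₂ i)) → (∀ j, β.r (b₁ j) (b₂ j)) →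
    δ.r (t.realize (Sum.elim a₁ b₁)) (t.realize (Sum.elim a₁ b₂)) →
    δ.r (t.realize (Sum.elim a₂ b₁)) (t.realize (Sum.elim a₂ b₂))

/-- The commutator `[α, β]`: the meet of all `δ` such that `C(α, β; δ)`. -/
def commutator (α β : Congruence L A) : Congruence L A :=
  sInf {δ | Centralizes α β δ}

variable (L A)

/-- `A` is Abelian if `[1_A, 1_A] = 0_A`. -/
def IsAbelian : Prop :=
  commutator (⊤ : Congruence L A) ⊤ = ⊥

end Commutator

section Affine

/-- An `n`-ary operation `f` on `A` is a polynomial of the algebra `A` if it arises from an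
`(n + m)`-ary term by substituting elements of `A` for the last `m` variables. -/
def IsPolynomial (L : FirstOrder.Language.{u, v}) {A : Type w} [L.Structure A] {n : ℕ}
    (f : (Fin n → A) → A) : Prop :=
  ∃ (m : ℕ) (t : L.Term (Fin n ⊕ Fin m)) (c : Fin m → A),
    ∀ x : Fin n → A, f x = t.realize (Sum.elim x c)

/-- Two algebras (of possibly different signatures) with the same underlying set `A` are
polynomially equivalent if they have the same polynomials. -/
def PolynomiallyEquivalent (L : FirstOrder.Language.{u, v}) (L' : FirstOrder.Language.{u', v'}) (A : Type w)
    [L.Structure A] [L'.Structure A] : Prop :=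
  ∀ (n : ℕ) (f : (Fin n → A) → A), IsPolynomial L f ↔ IsPolynomial L' f

/-- The operation symbols of modules over `R`: `0`, `-`, `+` and scalar multiplication by each
element of `R`. -/
inductive ModuleFunc (R : Type u) : ℕ → Type u
  | zero : ModuleFunc R 0
  | neg : ModuleFunc R 1
  | smul (r : R) : ModuleFunc R 1
  | add : ModuleFunc R 2

/-- The signature of modules over `R`. -/
def moduleLanguage (R : Type u) : FirstOrder.Language.{u, 0} where
  Functions := ModuleFunc R
  Relations := fun _ => Empty

/-- A module over a ring, viewed as an algebra. -/
instance moduleStructure (R : Type u) (A : Type w) [Ring R] [AddCommGroup A] [Module R A] :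
    (moduleLanguage R).Structure A where
  funMap := fun {_} f =>
    match f with
    | ModuleFunc.zero => fun _ => 0
    | ModuleFunc.neg => fun x => -x 0
    | ModuleFunc.smul r => fun x => r • x 0
    | ModuleFunc.add => fun x => x 0 + x 1
  RelMap := fun {_} r => nomatch r

/-- `A` is affine if it is polynomially equivalent to a module over a ring. It is no restriction
to take the ring in the universe of `A`: a ring acting on `A` may be replaced by its image in the
endomorphism ring of the additive group of `A`, with the same module polynomials. -/
def IsAffine (L : FirstOrder.Language.{u, v}) (A : Type w) [L.Structure A] : Prop :=
  ∃ (R : Type w) (_ : Ring R) (_ : AddCommGroup A) (_ : Module R A),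
    PolynomiallyEquivalent L (moduleLanguage R) A

end Affine

section Varieties

/-- An identity `s ≈ t` between terms in countably many variables. -/
structure Identity (L : FirstOrder.Language.{u, v}) where
  lhs : L.Term ℕ
  rhs : L.Term ℕ

/-- `A` belongs to the variety defined by the set of identities `E`, i.e. it satisfies every
identity in `E`. -/
def InVariety {L : FirstOrder.Language.{u, v}} (E : Set (Identity L)) (A : Type w) [L.Structure A] : Prop :=
  ∀ e ∈ E, ∀ x : ℕ → A, e.lhs.realize x = e.rhs.realize x

/-- The variety defined by `E` is congruence modular: the congruence lattice of each of its members
(in the universe `w`) is modular. -/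
def CongruenceModular {L : FirstOrder.Language.{u, v}} (E : Set (Identity L)) : Prop :=
  ∀ (B : Type w) [L.Structure B], InVariety E B → IsModularLattice (Congruence L B)

end Varieties

end UniversalAlgebra

/-! By the term condition modulo equality, affine algebras are Abelian: module polynomials preserve
`x + y = z + w`.

Conversely, the free algebra on `x₀, x₁, x₂, x₃` in the variety generated by `A` has a modular
congruence lattice. For suitable kernels `α`, `β`, `γ` of identifications of variables, with `γ ≤
α`, the modular law turns the path `x₀ β x₁ γ x₂ β x₃` into a chain from `x₀` to `x₃` with links in
`γ` or `β ⊓ α` (Day's terms). The term condition deforms a ternary term along this chain into a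
Mal'cev term `d` (`IsAbelian.exists_term_swap`, `IsAbelian.exists_isMaltsevTerm`).

The term condition also makes `d` commute with every term (`IsAbelian.realize_maltsev_comm`). Hence
`d x e y` is an Abelian group addition, `d x y z = x - y + z`, and polynomials are affine maps; the
scalars are the additive endomorphisms that are polynomials. -/

namespace UniversalAlgebra

open FirstOrder FirstOrder.Language FirstOrder.Language.Structure

/-! ### The term condition -/

section TermCondition

variable {L : FirstOrder.Language.{u, v}} {A : Type w} [L.Structure A]

/-- The term condition passes to intersections of the `δ`, so the commutator itself satisfies it. -/
theorem isAbelian_iff_centralizes :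
    IsAbelian L A ↔ Centralizes (⊤ : Congruence L A) ⊤ ⊥ := by
  constructor
  · intro h m n t a₁ a₂ b₁ b₂ ha hb hab
    have h' : (⊥ : Congruence L A) = sInf {δ | Centralizes (⊤ : Congruence L A) ⊤ δ} := h.symm
    rw [h'] at hab ⊢
    exact fun δ hδ => hδ m n t a₁ a₂ b₁ b₂ ha hb (hab δ hδ)
  · exact fun h => le_antisymm (sInf_le h) bot_le

/-- The term condition of an Abelian algebra, for four assignments that form a rectangle in each
variable. -/
theorem IsAbelian.realize_eq_of_rectangle (hA : IsAbelian L A) {ι : Type*} [Finite ι]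
    (t : L.Term ι) {v₁₁ v₁₂ v₂₁ v₂₂ : ι → A}
    (hv : ∀ i, (v₁₁ i = v₁₂ i ∧ v₂₁ i = v₂₂ i) ∨ (v₁₁ i = v₂₁ i ∧ v₁₂ i = v₂₂ i))
    (h : t.realize v₁₁ = t.realize v₁₂) : t.realize v₂₁ = t.realize v₂₂ := by
  classical
  obtain ⟨k, ⟨e⟩⟩ := Finite.exists_equiv_fin ι
  -- Both blocks get a slot for every variable; each variable uses only the slot in the block whose
  -- change moves it.
  let g : ι → Fin k ⊕ Fin k := fun i =>
    if v₁₁ i = v₁₂ i ∧ v₂₁ i = v₂₂ i then Sum.inl (e i) else Sum.inr (e i)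
  have key := isAbelian_iff_centralizes.1 hA k k (t.relabel g) (v₁₁ ∘ e.symm) (v₂₁ ∘ e.symm)
    (v₁₁ ∘ e.symm) (v₁₂ ∘ e.symm) (fun _ => trivial) (fun _ => trivial)
  have e₁₁ : Sum.elim (v₁₁ ∘ e.symm) (v₁₁ ∘ e.symm) ∘ g = v₁₁ := by
    funext i
    by_cases hi : v₁₁ i = v₁₂ i ∧ v₂₁ i = v₂₂ i <;> simp [g, hi]
  have e₁₂ : Sum.elim (v₁₁ ∘ e.symm) (v₁₂ ∘ e.symm) ∘ g = v₁₂ := by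
    funext i
    by_cases hi : v₁₁ i = v₁₂ i ∧ v₂₁ i = v₂₂ i <;> simp [g, hi]
  have e₂₁ : Sum.elim (v₂₁ ∘ e.symm) (v₁₁ ∘ e.symm) ∘ g = v₂₁ := by
    funext i
    by_cases hi : v₁₁ i = v₁₂ i ∧ v₂₁ i = v₂₂ i
    · simp [g, hi]
    · simpa [g, hi] using ((hv i).resolve_left hi).1
  have e₂₂ : Sum.elim (v₂₁ ∘ e.symm) (v₁₂ ∘ e.symm) ∘ g = v₂₂ := by
    funext i
    by_cases hi : v₁₁ i = v₁₂ i ∧ v₂₁ i = v₂₂ i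
    · simp [g, hi]
    · simpa [g, hi] using ((hv i).resolve_left hi).2
  simp only [Term.realize_relabel, e₁₁, e₁₂, e₂₁, e₂₂] at key
  exact key h

end TermCondition

/-! ### Meets and joins of congruences -/

section Join

variable {L : FirstOrder.Language.{u, v}} {A : Type w} [L.Structure A]

theorem Congruence.inf_r {φ ψ : Congruence L A} {x y : A} :
    (φ ⊓ ψ).r x y ↔ φ.r x y ∧ ψ.r x y := by
  refine ⟨fun h => ⟨(inf_le_left : φ ⊓ ψ ≤ φ) h, (inf_le_right : φ ⊓ ψ ≤ ψ) h⟩, fun h => ?_⟩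
  let χ : Congruence L A :=
    { r := fun a b => φ.r a b ∧ ψ.r a b
      iseqv := ⟨fun a => ⟨φ.iseqv.refl a, ψ.iseqv.refl a⟩,
        fun h => ⟨φ.iseqv.symm h.1, ψ.iseqv.symm h.2⟩,
        fun h₁ h₂ => ⟨φ.iseqv.trans h₁.1 h₂.1, ψ.iseqv.trans h₁.2 h₂.2⟩⟩
      compat := fun f x y h => ⟨φ.compat f x y fun i => (h i).1, ψ.compat f x y fun i => (h i).2⟩ }
  have hle : χ ≤ φ ⊓ ψ := le_inf (fun _ _ h => h.1) (fun _ _ h => h.2)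
  exact hle h

/-- Related elements of a join of two congruences are linked by a chain of steps in one or the
other. -/
theorem Congruence.reflTransGen_of_sup {φ ψ : Congruence L A} {x y : A} (h : (φ ⊔ ψ).r x y) :
    Relation.ReflTransGen (fun a b => φ.r a b ∨ ψ.r a b) x y := by
  let s : A → A → Prop := fun a b => φ.r a b ∨ ψ.r a b
  let θ : Congruence L A :=
    { r := Relation.ReflTransGen s
      iseqv := ⟨fun _ => .refl, fun h => by
        induction h with
        | refl => exact .refl
        | tail _ h ih => exact .head (h.imp φ.iseqv.symm ψ.iseqv.symm) ih, fun h₁ h₂ => h₁.trans h₂⟩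
      compat := fun {n} f x y hxy => by
        classical
        -- The arguments are changed one at a time, each along its own chain.
        suffices H : ∀ t : Finset (Fin n),
            Relation.ReflTransGen s (funMap f x) (funMap f (t.piecewise y x)) by
          simpa using H Finset.univ
        intro t
        induction t using Finset.induction_on with
        | empty => simp [Relation.ReflTransGen.refl]
        | insert a t ha ih =>
          refine ih.trans ?_
          rw [Finset.piecewise_insert]
          have hx : t.piecewise y x = Function.update (t.piecewise y x) a (x a) := by
            rw [eq_comm, Function.update_eq_self_iff]
            simp [ha]
          conv => lhs; rw [hx]
          refine Relation.ReflTransGen.lift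
            (fun b => funMap f (Function.update (t.piecewise y x) a b)) (fun b c hbc => ?_) _ _
            (hxy a)
          refine hbc.imp (fun hbc => φ.compat f _ _ fun i => ?_)
            (fun hbc => ψ.compat f _ _ fun i => ?_)
          · by_cases hi : i = a
            · subst hi
              simpa using hbc
            · simp [hi]
          · by_cases hi : i = a
            · subst hi
              simpa using hbc
            · simp [hi] }
  have hle : φ ⊔ ψ ≤ θ :=
    sup_le (fun _ _ h => .single (.inl h)) (fun _ _ h => .single (.inr h))
  exact hle h

end Join

/-! ### The free algebra on four generators -/

section TermFunctions

variable (L : FirstOrder.Language.{u, v}) (A : Type w) [L.Structure A]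

/-- The algebra of `4`-ary term functions of `A`: the free algebra on four generators in the
variety generated by `A`. -/
def TermFunction : Type max u w :=
  -- The lift reaches the universe in which modularity is assumed.
  ULift.{u} {f : (Fin 4 → A) → A // ∃ t : L.Term (Fin 4), ∀ x, f x = t.realize x}

variable {L A}

namespace TermFunction

instance : CoeFun (TermFunction L A) fun _ => (Fin 4 → A) → A := ⟨fun f => f.down.1⟩

/-- The term function of a term. -/
def ofTerm (t : L.Term (Fin 4)) : TermFunction L A := ⟨fun x => t.realize x, t, fun _ => rfl⟩

theorem exists_term (f : TermFunction L A) : ∃ t : L.Term (Fin 4), ∀ x, f x = t.realize x :=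
  f.down.2

theorem ext {f g : TermFunction L A} (h : ∀ x, f x = g x) : f = g :=
  ULift.ext _ _ (Subtype.ext (funext h))

instance : L.Structure (TermFunction L A) where
  funMap F fs := ⟨fun x => funMap F fun i => fs i x,
    Term.func F fun i => (fs i).exists_term.choose,
    fun x => congrArg (funMap F) (funext fun i => (fs i).exists_term.choose_spec x)⟩
  RelMap _ _ := False

theorem funMap_apply {n : ℕ} (F : L.Functions n) (fs : Fin n → TermFunction L A)
    (x : Fin 4 → A) : (funMap F fs) x = funMap F fun i => fs i x := rfl

theorem realize_apply {α : Type*} (t : L.Term α) (fs : α → TermFunction L A) (x : Fin 4 → A) :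
    (t.realize fs) x = t.realize fun i => fs i x := by
  induction t with
  | var => rfl
  | func F ts ih => simp only [Term.realize_func, funMap_apply, ih]

theorem inVariety {E : Set (Identity L)} (hA : InVariety E A) : InVariety E (TermFunction L A) :=
  fun e he fs => ext fun x => by simp only [realize_apply, hA e he]

/-- The congruence that identifies the term functions that agree on all assignments from `S`. -/
def agreeOn (S : Set (Fin 4 → A)) : Congruence L (TermFunction L A) where
  r f g := ∀ x ∈ S, f x = g x
  iseqv := ⟨fun _ _ _ => rfl, fun h x hx => (h x hx).symm,
    fun h₁ h₂ x hx => (h₁ x hx).trans (h₂ x hx)⟩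
  compat F fs gs h x hx := by
    simp only [funMap_apply]
    exact congrArg _ (funext fun i => h i x hx)

end TermFunction

end TermFunctions

/-! ### From Day's chain to a Mal'cev term -/

section Maltsev

variable {L : FirstOrder.Language.{u, v}} {A : Type w} [L.Structure A]

/-- A term that defines a Mal'cev operation on `A`. -/
def IsMaltsevTerm (A : Type w) [L.Structure A] (d : L.Term (Fin 3)) : Prop :=
  ∀ x y : A, d.realize ![x, x, y] = y ∧ d.realize ![x, y, y] = x

/-- If `m(x, y, y, x) = x`, the third variable of `m(y, y, z, x)`, `z ∈ {x, y}`, may be replaced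
along a rectangle without losing the representation by a ternary term `q` with `q(x, x, z) = z`. -/
theorem IsAbelian.exists_term_swap (hA : IsAbelian L A) (m : L.Term (Fin 4))
    (hm : ∀ x y : A, m.realize ![x, y, y, x] = x) (c c' : Fin 2) (q : L.Term (Fin 3))
    (hq : ∀ x z : A, q.realize ![x, x, z] = z)
    (hqm : ∀ x y : A, q.realize ![x, y, y] = m.realize ![y, y, ![x, y] c, x]) :
    ∃ q' : L.Term (Fin 3), (∀ x z : A, q'.realize ![x, x, z] = z) ∧
      ∀ x y : A, q'.realize ![x, y, y] = m.realize ![y, y, ![x, y] c', x] := by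
  -- This is `m(q, u, u', q)`, with `u`, `u'` the variables picked by `c`, `c'`. At `(x, x, z)` both
  -- are `x`, which leaves `m(z, x, x, z) = z`.
  refine ⟨m.subst ![q, Term.var (Fin.castSucc c), Term.var (Fin.castSucc c'), q], ?_, ?_⟩
  · intro x z
    have : (fun a => (![q, Term.var (Fin.castSucc c), Term.var (Fin.castSucc c'), q] a).realize
        ![x, x, z]) = ![z, x, x, z] := by
      funext a
      fin_cases a <;> fin_cases c <;> fin_cases c' <;> simp [hq]
    rw [Term.realize_subst, this, hm]
  · intro x y
    set p := q.realize ![x, y, y] with hp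
    have : (fun a => (![q, Term.var (Fin.castSucc c), Term.var (Fin.castSucc c'), q] a).realize
        ![x, y, y]) = ![p, ![x, y] c, ![x, y] c', p] := by
      funext a
      fin_cases a <;> fin_cases c <;> fin_cases c' <;> simp [hp]
    rw [Term.realize_subst, this]
    -- Since `m(p, u, u, p) = p = m(y, y, u, x)`, the third argument `u` may become `u'` on both
    -- sides.
    refine hA.realize_eq_of_rectangle m (v₁₁ := ![p, ![x, y] c, ![x, y] c, p])
      (v₁₂ := ![y, y, ![x, y] c, x]) ?_ ?_
    · intro a
      fin_cases a <;> simp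
    · rw [hm, hp, hqm]

/-- A term `q` with `q(x, x, z) = z` is deformed along Day's chain so that `q(x, y, y)` follows
`f(y, y, x, x)`. It starts as the third projection at `π 0` and is Mal'cev at `π 3`, where `f(y, y,
x, x) = x`. -/
theorem IsAbelian.exists_isMaltsevTerm {E : Set (Identity L)}
    (hE : CongruenceModular.{u, v, max u w} E) (hA : InVariety E A) (hAb : IsAbelian L A) :
    ∃ d : L.Term (Fin 3), IsMaltsevTerm A d := by
  have := hE _ (TermFunction.inVariety hA)
  let α : Congruence L (TermFunction L A) := TermFunction.agreeOn {v | ∃ x y, v = ![x, y, y, x]}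
  let β : Congruence L (TermFunction L A) := TermFunction.agreeOn {v | ∃ x y, v = ![y, y, x, x]}
  let γ : Congruence L (TermFunction L A) := TermFunction.agreeOn {v | ∃ x y z, v = ![x, y, y, z]}
  let π : Fin 4 → TermFunction L A := fun i => .ofTerm (Term.var i)
  have hγα : γ ≤ α := by
    rintro f g h v ⟨x, y, rfl⟩
    exact h _ ⟨x, y, x, rfl⟩
  have h₀₁ : (γ ⊔ β).r (π 0) (π 1) := (le_sup_right : β ≤ γ ⊔ β) <| by
    rintro v ⟨x, y, rfl⟩
    rfl
  have h₁₂ : (γ ⊔ β).r (π 1) (π 2) := (le_sup_left : γ ≤ γ ⊔ β) <| by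
    rintro v ⟨x, y, z, rfl⟩
    rfl
  have h₂₃ : (γ ⊔ β).r (π 2) (π 3) := (le_sup_right : β ≤ γ ⊔ β) <| by
    rintro v ⟨x, y, rfl⟩
    rfl
  have h₀₃ : α.r (π 0) (π 3) := by
    rintro v ⟨x, y, rfl⟩
    rfl
  have key : (γ ⊔ β ⊓ α).r (π 0) (π 3) := by
    rw [← sup_inf_assoc_of_le β hγα, Congruence.inf_r]
    exact ⟨(γ ⊔ β).iseqv.trans ((γ ⊔ β).iseqv.trans h₀₁ h₁₂) h₂₃, h₀₃⟩
  have chain : ∀ f, Relation.ReflTransGen (fun f g => γ.r f g ∨ (β ⊓ α).r f g) (π 0) f →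
      (∀ x y, f ![x, y, y, x] = x) ∧ ∃ q : L.Term (Fin 3), (∀ x z : A, q.realize ![x, x, z] = z) ∧
        ∀ x y : A, q.realize ![x, y, y] = f ![y, y, x, x] := by
    intro f hf
    induction hf with
    | refl => exact ⟨fun _ _ => rfl, Term.var 2, fun _ _ => rfl, fun _ _ => rfl⟩
    | @tail f g _ hfg ih =>
      obtain ⟨hf, q, hq, hqf⟩ := ih
      have hg : ∀ x y, g ![x, y, y, x] = x := by
        intro x y
        have hα : α.r f g := hfg.elim (fun h => hγα h) (fun h => (Congruence.inf_r.1 h).2)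
        rw [← hα _ ⟨x, y, rfl⟩, hf]
      refine ⟨hg, ?_⟩
      rcases hfg with hγ | hβ
      -- `γ` does not compare values at `(y, y, x, x)` but does at `(y, y, y, x)`: swap the third
      -- argument to `y`, pass from `f` to `g`, swap back.
      · obtain ⟨m, hm⟩ := f.exists_term
        obtain ⟨m', hm'⟩ := g.exists_term
        obtain ⟨q₁, hq₁, hqm₁⟩ := hAb.exists_term_swap m (fun x y => by rw [← hm, hf]) 0 1 q hq
          (fun x y => by rw [← hm, hqf]; rfl)
        obtain ⟨q₂, hq₂, hqm₂⟩ := hAb.exists_term_swap m' (fun x y => by rw [← hm', hg]) 1 0 q₁ hq₁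
          (fun x y => by rw [hqm₁, ← hm, ← hm']; exact hγ _ ⟨y, y, x, rfl⟩)
        exact ⟨q₂, hq₂, fun x y => by rw [hqm₂, ← hm']; rfl⟩
      · exact ⟨q, hq, fun x y => by rw [hqf, (Congruence.inf_r.1 hβ).1 _ ⟨x, y, rfl⟩]⟩
  obtain ⟨-, q, hq, hq'⟩ := chain _ (Congruence.reflTransGen_of_sup key)
  exact ⟨q, fun x y => ⟨hq x y, hq' x y⟩⟩

end Maltsev

/-! ### Closure properties of polynomials -/

section Polynomials

variable {L : FirstOrder.Language.{u, v}} {A : Type w} [L.Structure A] {n : ℕ}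

/-- Polynomials are the operations given by terms with parameters from `A`. -/
theorem isPolynomial_iff_exists_term {f : (Fin n → A) → A} :
    IsPolynomial L f ↔ ∃ t : L.Term (A ⊕ Fin n), ∀ x, f x = t.realize (Sum.elim id x) := by
  classical
  constructor
  · rintro ⟨m, t, c, h⟩
    refine ⟨t.relabel (Sum.elim Sum.inr (Sum.inl ∘ c)), fun x => ?_⟩
    rw [h, Term.realize_relabel]
    congr 1
    funext i
    cases i <;> rfl
  · rintro ⟨t, h⟩
    -- Only finitely many parameters occur in a term.
    let e := t.varFinsetLeft.equivFin
    refine ⟨_, (t.restrictVarLeft e).relabel Sum.swap, fun i => e.symm i, fun x => ?_⟩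
    rw [h, Term.realize_relabel, Term.realize_restrictVarLeft (xs' := id)]
    · rfl
    · intro a
      simp

theorem isPolynomial_proj (i : Fin n) : IsPolynomial L fun x : Fin n → A => x i :=
  isPolynomial_iff_exists_term.2 ⟨Term.var (Sum.inr i), fun _ => rfl⟩

theorem isPolynomial_const (c : A) : IsPolynomial L fun _ : Fin n → A => c :=
  isPolynomial_iff_exists_term.2 ⟨Term.var (Sum.inl c), fun _ => rfl⟩

theorem IsPolynomial.comp {k : ℕ} {f : (Fin k → A) → A} (hf : IsPolynomial L f)
    {g : Fin k → (Fin n → A) → A} (hg : ∀ i, IsPolynomial L (g i)) :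
    IsPolynomial L fun x => f fun i => g i x := by
  simp only [isPolynomial_iff_exists_term] at hf hg ⊢
  obtain ⟨t, ht⟩ := hf
  choose s hs using hg
  refine ⟨t.subst (Sum.elim (fun a => Term.var (Sum.inl a)) s), fun x => ?_⟩
  rw [ht, Term.realize_subst]
  congr 1
  funext i
  cases i with
  | inl a => rfl
  | inr i => exact hs i x

theorem IsPolynomial.comp₁ {f : A → A} (hf : IsPolynomial L fun x : Fin 1 → A => f (x 0))
    {g : (Fin n → A) → A} (hg : IsPolynomial L g) : IsPolynomial L fun x => f (g x) :=
  hf.comp (g := ![g]) (by simpa using hg)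

theorem IsPolynomial.comp₂ {f : A → A → A}
    (hf : IsPolynomial L fun x : Fin 2 → A => f (x 0) (x 1)) {g h : (Fin n → A) → A}
    (hg : IsPolynomial L g) (hh : IsPolynomial L h) : IsPolynomial L fun x => f (g x) (h x) :=
  hf.comp (g := ![g, h]) (by simpa [Fin.forall_fin_two] using ⟨hg, hh⟩)

theorem isPolynomial_realize (t : L.Term (Fin n)) :
    IsPolynomial L fun x : Fin n → A => t.realize x :=
  isPolynomial_iff_exists_term.2 ⟨t.relabel Sum.inr, fun x => by
    rw [Term.realize_relabel]; rfl⟩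

theorem isPolynomial_funMap (F : L.Functions n) :
    IsPolynomial L fun x : Fin n → A => funMap F x :=
  isPolynomial_realize F.term

/-- A class of operations that contains projections, constants and is closed under the fundamental
operations contains the polynomials. -/
theorem IsPolynomial.induction {P : ((Fin n → A) → A) → Prop} (proj : ∀ i, P fun x => x i)
    (const : ∀ c, P fun _ => c)
    (funMap : ∀ {k : ℕ} (F : L.Functions k) (g : Fin k → (Fin n → A) → A), (∀ i, P (g i)) →
      P fun x => funMap F fun i => g i x)
    {f : (Fin n → A) → A} (hf : IsPolynomial L f) : P f := by
  obtain ⟨t, ht⟩ := isPolynomial_iff_exists_term.1 hf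
  obtain rfl : f = fun x => t.realize (Sum.elim id x) := funext ht
  clear ht hf
  induction t with
  | var i =>
    cases i with
    | inl a => exact const a
    | inr i => exact proj i
  | func F ts ih => exact funMap F _ ih

end Polynomials

/-! ### Polynomials of modules -/

section ModulePolynomials

variable {R : Type u} {A : Type w} [Ring R] [AddCommGroup A] [Module R A] {n : ℕ}

theorem isPolynomial_module_smul (r : R) :
    IsPolynomial (moduleLanguage R) fun x : Fin 1 → A => r • x 0 :=
  isPolynomial_funMap (L := moduleLanguage R) (ModuleFunc.smul r)

theorem isPolynomial_module_add :
    IsPolynomial (moduleLanguage R) fun x : Fin 2 → A => x 0 + x 1 :=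
  isPolynomial_funMap (L := moduleLanguage R) ModuleFunc.add

theorem isPolynomial_module_sum_smul (r : Fin n → R) (s : Finset (Fin n)) :
    IsPolynomial (moduleLanguage R) fun x : Fin n → A => ∑ i ∈ s, r i • x i := by
  induction s using Finset.induction_on with
  | empty => simpa using isPolynomial_const (0 : A)
  | insert a s ha ih =>
    simp only [Finset.sum_insert ha]
    exact isPolynomial_module_add.comp₂ ((isPolynomial_module_smul (r a)).comp₁
      (isPolynomial_proj a)) ih

/-- Module polynomials preserve the relation `x + y = z + w`. -/
theorem IsPolynomial.map_add_eq_map_add {f : (Fin n → A) → A}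
    (hf : IsPolynomial (moduleLanguage R) f) {x y z w : Fin n → A} (h : x + y = z + w) :
    f x + f y = f z + f w := by
  refine IsPolynomial.induction (P := fun f => f x + f y = f z + f w) (fun i => congrFun h i)
    (fun _ => rfl) (fun {k} F g hg => ?_) hf
  cases F with
  | zero => rfl
  | neg =>
    change -g 0 x + -g 0 y = -g 0 z + -g 0 w
    rw [← neg_add, hg 0, neg_add]
  | smul r =>
    change r • g 0 x + r • g 0 y = r • g 0 z + r • g 0 w
    rw [← smul_add, hg 0, smul_add]
  | add =>
    change (g 0 x + g 1 x) + (g 0 y + g 1 y) = (g 0 z + g 1 z) + (g 0 w + g 1 w)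
    rw [add_add_add_comm, hg 0, hg 1, add_add_add_comm]

end ModulePolynomials

/-! ### Affine algebras -/

section Affine

variable {L : FirstOrder.Language.{u, v}} {A : Type w} [L.Structure A]

theorem IsAffine.isAbelian (h : IsAffine L A) : IsAbelian L A := by
  obtain ⟨R, _, _, _, h⟩ := h
  rw [isAbelian_iff_centralizes]
  intro m n t a₁ a₂ b₁ b₂ _ _ hab
  change t.realize _ = t.realize _ at hab ⊢
  -- The corners satisfy `(a₁, b₁) + (a₂, b₂) = (a₁, b₂) + (a₂, b₁)`, hence so do the values of `t`.
  have key := ((h _ _).1 (isPolynomial_realize (A := A)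
    (t.relabel finSumFinEquiv))).map_add_eq_map_add
    (x := Sum.elim a₁ b₁ ∘ finSumFinEquiv.symm) (y := Sum.elim a₂ b₂ ∘ finSumFinEquiv.symm)
    (z := Sum.elim a₁ b₂ ∘ finSumFinEquiv.symm) (w := Sum.elim a₂ b₁ ∘ finSumFinEquiv.symm) (by
      funext i
      obtain ⟨j, rfl⟩ := finSumFinEquiv.surjective i
      cases j <;> simp [add_comm])
  simp only [Term.realize_relabel, Function.comp_assoc, Equiv.symm_comp_self,
    Function.comp_id, hab] at key
  exact (add_left_cancel key).symm

/-- The ring of the endomorphisms of the additive group `A` that are polynomials of `A`. -/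
def polynomialEnd (L : FirstOrder.Language.{u, v}) (A : Type w) [L.Structure A] [AddCommGroup A]
    (hadd : IsPolynomial L fun x : Fin 2 → A => x 0 + x 1)
    (hneg : IsPolynomial L fun x : Fin 1 → A => -x 0) : Subring (AddMonoid.End A) where
  carrier := {φ | IsPolynomial L fun x : Fin 1 → A => φ (x 0)}
  mul_mem' hφ hψ := IsPolynomial.comp₁ hφ hψ
  one_mem' := isPolynomial_proj 0
  add_mem' hφ hψ := hadd.comp₂ hφ hψ
  zero_mem' := isPolynomial_const 0
  neg_mem' hφ := hneg.comp₁ hφ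

/-- An algebra with polynomial group operations whose polynomials are affine maps is affine. -/
theorem isAffine_of_map_add [AddCommGroup A]
    (hadd : IsPolynomial L fun x : Fin 2 → A => x 0 + x 1)
    (hneg : IsPolynomial L fun x : Fin 1 → A => -x 0)
    (hmap : ∀ {n : ℕ} (f : (Fin n → A) → A), IsPolynomial L f →
      ∀ x y, f (x + y) = f x - f 0 + f y) : IsAffine L A := by
  refine ⟨polynomialEnd L A hadd hneg, inferInstance, inferInstance, inferInstance,
    fun n f => ⟨fun hf => ?_, fun hf => ?_⟩⟩
  -- Removing the constant `f 0` leaves an additive map, the sum of its restrictions `r i` to the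
  -- coordinates.
  · let g : (Fin n → A) →+ A := AddMonoidHom.mk' (fun x => f x - f 0) fun x y => by
      rw [hmap f hf]; abel
    let r : Fin n → polynomialEnd L A hadd hneg := fun i =>
      ⟨g.comp (AddMonoidHom.single (fun _ => A) i), by
        change IsPolynomial L fun x : Fin 1 → A => f (Pi.single i (x 0)) - f 0
        simp only [sub_eq_add_neg]
        refine hadd.comp₂ (hf.comp (g := fun j x => Pi.single (M := fun _ => A) i (x 0) j)
          fun j => ?_) (isPolynomial_const _)
        by_cases hj : j = i
        · subst hj
          simpa using isPolynomial_proj 0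
        · simpa [hj] using isPolynomial_const 0⟩
    have hfr : f = fun x => (∑ i, r i • x i) + f 0 := by
      funext x
      have hx : g x = ∑ i, r i • x i := by
        conv_lhs => rw [← Finset.univ_sum_single x, map_sum]
        rfl
      rw [← hx]
      change f x = f x - f 0 + f 0
      abel
    rw [hfr]
    exact isPolynomial_module_add.comp₂ (isPolynomial_module_sum_smul r Finset.univ)
      (isPolynomial_const _)
  · refine IsPolynomial.induction isPolynomial_proj isPolynomial_const (fun {k} F g hg => ?_) hf
    cases F with
    | zero => exact isPolynomial_const 0
    | neg => exact hneg.comp₁ (hg 0)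
    | smul r => exact IsPolynomial.comp₁ r.2 (hg 0)
    | add => exact hadd.comp₂ (hg 0) (hg 1)

end Affine

/-! ### From a Mal'cev term to a module -/

section Maltsev

variable {A : Type w}

/-- The Abelian group with zero element `e` that is determined by a Mal'cev operation that commutes
with itself. -/
abbrev addCommGroupOfMaltsev (d : A → A → A → A) (h₁ : ∀ x y, d x x y = y)
    (h₂ : ∀ x y, d x y y = x)
    (hd : ∀ x₁ x₂ x₃ y₁ y₂ y₃ z₁ z₂ z₃, d (d x₁ y₁ z₁) (d x₂ y₂ z₂) (d x₃ y₃ z₃) =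
      d (d x₁ x₂ x₃) (d y₁ y₂ y₃) (d z₁ z₂ z₃)) (e : A) : AddCommGroup A :=
  letI : Add A := ⟨fun x y => d x e y⟩
  letI : Zero A := ⟨e⟩
  letI : Neg A := ⟨fun x => d e x e⟩
  -- Associativity, inverses and commutativity apply `hd` to `3 × 3` matrices filled up with `e`.
  { AddGroup.ofLeftAxioms
      (fun x y z => show d (d x e y) e z = d x e (d y e z) by
        have := hd x e y e e e e e z
        simpa only [h₁, h₂] using this.symm)
      (fun x => h₁ e x)
      (fun x => show d (d e x e) e x = e by
        have := hd e x e e e e e e x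
        simpa only [h₁, h₂] using this.symm) with
    add_comm := fun x y => show d x e y = d y e x by
      have := hd e e x e e e y e e
      simpa only [h₁, h₂] using this.symm }

variable {L : FirstOrder.Language.{u, v}} [L.Structure A]

/-- A Mal'cev term of an Abelian algebra commutes with every term. -/
theorem IsAbelian.realize_maltsev_comm (hA : IsAbelian L A) {d : L.Term (Fin 3)}
    (hd : IsMaltsevTerm A d) {ι : Type*} [Finite ι] (t : L.Term ι) (x y z : ι → A) :
    t.realize (fun i => d.realize ![x i, y i, z i]) =
      d.realize ![t.realize x, t.realize y, t.realize z] := by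
  let T : Fin 3 → L.Term (Option (Fin 3 × ι)) := fun k => t.relabel fun i => some (k, i)
  let D : L.Term (Option (Fin 3 × ι)) := d.subst T
  let S : L.Term (Option (Fin 3 × ι)) :=
    t.subst fun i => d.relabel fun k => some (k, i)
  let H : L.Term (Option (Fin 3 × ι)) := d.subst ![D, S, Term.var none]
  let V : A → (ι → A) → (ι → A) → (ι → A) → Option (Fin 3 × ι) → A := fun c x y z o =>
    o.elim c fun p => ![x, y, z] p.1 p.2
  have hD : ∀ c x y z, D.realize (V c x y z) =
      d.realize ![t.realize x, t.realize y, t.realize z] := by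
    intro c x y z
    simp only [D, T, Term.realize_subst, Term.realize_relabel]
    congr 1
    funext k
    fin_cases k <;> rfl
  have hS : ∀ c x y z, S.realize (V c x y z) =
      t.realize fun i => d.realize ![x i, y i, z i] := by
    intro c x y z
    simp only [S, Term.realize_subst, Term.realize_relabel]
    congr 1
    funext i
    congr 1
    funext k
    fin_cases k <;> rfl
  have hH : ∀ c x y z, H.realize (V c x y z) =
      d.realize ![d.realize ![t.realize x, t.realize y, t.realize z],
        t.realize (fun i => d.realize ![x i, y i, z i]), c] := by
    intro c x y z
    simp only [H, Term.realize_subst]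
    congr 1
    funext k
    fin_cases k
    · exact hD c x y z
    · exact hS c x y z
    · rfl
  -- `H` takes the value `c` at `(x, y, y)` and at `(y, y, y)`. Replacing the last `y` by `z` gives
  -- `d(D, c, c) = d(t z, t z, c)`, that is, `D = c`.
  set c := t.realize fun i => d.realize ![x i, y i, z i] with hc
  have key := hA.realize_eq_of_rectangle H (v₁₁ := V c x y y) (v₁₂ := V c y y y)
    (v₂₁ := V c x y z) (v₂₂ := V c y y z)
    (by
      rintro (_ | ⟨k, i⟩)
      · simp [V]
      · fin_cases k <;> simp [V])
    (by simp only [hH, (hd _ _).2, (hd _ _).1])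
  simp only [hH, (hd _ _).1, ← hc, (hd _ _).2] at key
  exact key.symm

theorem IsAbelian.isAffine_of_isMaltsevTerm [Nonempty A] (hA : IsAbelian L A)
    {d : L.Term (Fin 3)} (hd : IsMaltsevTerm A d) : IsAffine L A := by
  obtain ⟨e⟩ := ‹Nonempty A›
  let D : A → A → A → A := fun x y z => d.realize ![x, y, z]
  have h₁ : ∀ x y, D x x y = y := fun x y => (hd x y).1
  have h₂ : ∀ x y, D x y y = x := fun x y => (hd x y).2
  have hcomm : ∀ x₁ x₂ x₃ y₁ y₂ y₃ z₁ z₂ z₃, D (D x₁ y₁ z₁) (D x₂ y₂ z₂) (D x₃ y₃ z₃) =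
      D (D x₁ x₂ x₃) (D y₁ y₂ y₃) (D z₁ z₂ z₃) := by
    intro x₁ x₂ x₃ y₁ y₂ y₃ z₁ z₂ z₃
    have := hA.realize_maltsev_comm hd d ![x₁, x₂, x₃] ![y₁, y₂, y₃] ![z₁, z₂, z₃]
    refine Eq.trans ?_ this
    change d.realize _ = _
    congr 1
    funext k
    fin_cases k <;> rfl
  let := addCommGroupOfMaltsev D h₁ h₂ hcomm e
  have add_def : ∀ x y : A, x + y = D x e y := fun _ _ => rfl
  have neg_def : ∀ x : A, -x = D e x e := fun _ => rfl
  have D_eq : ∀ x y z : A, D x y z = x - y + z := by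
    intro x y z
    have hxy : x - y = D x y e := by
      rw [sub_eq_add_neg, add_def, neg_def]
      have := hcomm x e e e e y e e e
      simpa only [h₁, h₂] using this
    rw [hxy, add_def]
    have := hcomm x y e e e e e e z
    simpa only [h₁, h₂] using this
  have hD : IsPolynomial L fun x : Fin 3 → A => D (x 0) (x 1) (x 2) := by
    refine cast (congrArg _ (funext fun x => ?_)) (isPolynomial_realize (A := A) d)
    change d.realize x = d.realize _
    congr 1
    funext k
    fin_cases k <;> rfl
  refine isAffine_of_map_add ?_ ?_ fun {n} f hf x y => ?_
  · exact hD.comp (g := ![fun x => x 0, fun _ => e, fun x => x 1]) fun k => by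
      fin_cases k
      exacts [isPolynomial_proj 0, isPolynomial_const e, isPolynomial_proj 1]
  · exact hD.comp (g := ![fun _ => e, fun x => x 0, fun _ => e]) fun k => by
      fin_cases k
      exacts [isPolynomial_const e, isPolynomial_proj 0, isPolynomial_const e]
  · obtain ⟨m, t, c, ht⟩ := hf
    -- Here `x + y` is `d(x, 0, y)`, and each parameter is `d(c j, c j, c j)`.
    have := hA.realize_maltsev_comm hd t (Sum.elim x c) (Sum.elim 0 c) (Sum.elim y c)
    rw [ht x, ht 0, ht y, ht, ← D_eq]
    change _ = d.realize _
    rw [← this]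
    congr 1
    funext i
    cases i with
    | inl i => rfl
    | inr j => exact (h₁ _ _).symm

end Maltsev

end UniversalAlgebra

/-- The variety is given by its defining identities `E`. Its members are tested for congruence
modularity in a universe that contains both its free algebras on finitely many generators and `A`. -/
theorem mainTheorem1 (L : FirstOrder.Language.{u, v}) [L.IsAlgebraic]
    (E : Set (UniversalAlgebra.Identity L))
    (hE : UniversalAlgebra.CongruenceModular.{u, v, max u w} E)
    (A : Type w) [Nonempty A] [L.Structure A] (hA : UniversalAlgebra.InVariety E A) :
    UniversalAlgebra.IsAbelian L A ↔ UniversalAlgebra.IsAffine L A := by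
  refine ⟨fun h => ?_, fun h => h.isAbelian⟩
  obtain ⟨d, hd⟩ := h.exists_isMaltsevTerm hE hA
  exact h.isAffine_of_isMaltsevTerm hd
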